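/- Let $\mathbb{Q}^{ab}$ denote the maximal abelian extension of $\mathbb{Q}$ (the compositum, inside a fixed algebraic closure $\overline{\mathbb{Q}}$, of all Galois extensions of $\mathbb{Q}$ with abelian Galois group). Let $E$ be an elliptic curve over $\mathbb{Q}$ such that $E(\mathbb{Q}^{ab})$ contains a point of order $4$, but the full $4$-torsion of $E$ is not defined over $\mathbb{Q}^{ab}$, i.e. $E(\overline{\mathbb{Q}})[4] \not\subseteq E(\mathbb{Q}^{ab})$. Then there are $b, d \in \mathbb{Q}$ such that $E$ is isomorphic over $\mathbb{Q}$ to the curve $$y^2 = x(x^2 + bx + d)$$ and at least one of $d$ and $(b^2-4d)d$ is a non-zero perfect square in $\mathbb{Q}$. -/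

import Mathlib

open WeierstrassCurve

/-- The maximal abelian extension of a field `F` inside its algebraic closure: the compositum of
all Galois extensions of `F` in the algebraic closure whose Galois group is abelian. -/
noncomputable def maximalAbelianExtension (F : Type*) [Field F] :
    IntermediateField F (AlgebraicClosure F) :=
  ⨆ K : {K : IntermediateField F (AlgebraicClosure F) // IsAbelianGalois F K}, K.1

theorem le_maximalAbelianExtension {F : Type*} [Field F]
    (K : IntermediateField F (AlgebraicClosure F)) (hK : IsAbelianGalois F K) :
    K ≤ maximalAbelianExtension F :=
  le_iSup (fun K : {K : IntermediateField F (AlgebraicClosure F) // IsAbelianGalois F K} => K.1)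
    ⟨K, hK⟩

/-- The maximal abelian extension is itself an abelian Galois extension. -/
theorem isAbelianGalois_maximalAbelianExtension (F : Type*) [Field F] :
    IsAbelianGalois F (maximalAbelianExtension F) := by
  have h1 : Normal F (maximalAbelianExtension F) := by
    have : ∀ K : {K : IntermediateField F (AlgebraicClosure F) // IsAbelianGalois F K},
        Normal F K.1 := fun K => by
      have := K.2
      infer_instance
    exact IntermediateField.normal_iSup F (AlgebraicClosure F) _
  have h2 : Algebra.IsSeparable F (maximalAbelianExtension F) := by
    have : ∀ K : {K : IntermediateField F (AlgebraicClosure F) // IsAbelianGalois F K},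
        Algebra.IsSeparable F K.1 := fun K => by
      have := K.2
      infer_instance
    exact IntermediateField.isSeparable_iSup _ _ (h := this)
  have hG : IsGalois F (maximalAbelianExtension F) := ⟨⟩
  have key : ∀ (σ τ : Gal(AlgebraicClosure F/F)) (x : AlgebraicClosure F),
      x ∈ maximalAbelianExtension F → σ (τ x) = τ (σ x) := by
    intro σ τ x hx
    have hle : maximalAbelianExtension F ≤
        IntermediateField.fixedField (Subgroup.zpowers ((τ * σ)⁻¹ * (σ * τ))) := by
      refine iSup_le fun K => ?_
      obtain ⟨K, hK⟩ := K
      intro y hy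
      have e : AlgEquiv.restrictNormalHom K ((τ * σ)⁻¹ * (σ * τ)) = 1 := by
        rw [map_mul, map_inv, map_mul, map_mul,
          hK.is_comm.comm (AlgEquiv.restrictNormalHom K σ) (AlgEquiv.restrictNormalHom K τ),
          inv_mul_cancel]
      rw [IntermediateField.mem_fixedField_iff]
      intro f hf
      have e' : AlgEquiv.restrictNormalHom K f = 1 := by
        obtain ⟨n, rfl⟩ := Subgroup.mem_zpowers_iff.mp hf
        rw [map_zpow, e, one_zpow]
      have := AlgEquiv.restrictNormal_commutes f K ⟨y, hy⟩
      change ((AlgEquiv.restrictNormalHom K f ⟨y, hy⟩ : K) : AlgebraicClosure F) = f y at this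
      rw [← this, e']
      rfl
    have h := (IntermediateField.mem_fixedField_iff _ _).mp (hle hx) _
      (Subgroup.mem_zpowers ((τ * σ)⁻¹ * (σ * τ)))
    have h' := congrArg (τ * σ) h
    rw [← AlgEquiv.mul_apply, mul_inv_cancel_left] at h'
    exact h'
  refine { toIsGalois := hG, is_comm := ⟨fun σ τ => ?_⟩ }
  ext x
  have c := fun (ρ : Gal(maximalAbelianExtension F/F)) (y : maximalAbelianExtension F) =>
    AlgEquiv.liftNormal_commutes ρ (AlgebraicClosure F) y
  have h := key (σ.liftNormal (AlgebraicClosure F)) (τ.liftNormal (AlgebraicClosure F)) x x.2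
  have hx : (x : AlgebraicClosure F) = algebraMap (maximalAbelianExtension F) _ x := rfl
  rw [hx, c, c, c, c] at h
  exact h

open scoped Classical in
/-- `E` has a point of exact order `n` defined over `K`. -/
def WeierstrassCurve.HasPointOfOrderOver {F : Type*} [Field F] (E : WeierstrassCurve F) (n : ℕ)
    (K : Type*) [Field K] [Algebra F K] : Prop :=
  ∃ P : (Affine.baseChange E K).Point, addOrderOf P = n

open scoped Classical in
/-- The full `n`-torsion of `E` is defined over the subextension `K` of the algebraically closed
field `L`: every `n`-torsion point of `E` over `L` comes from a `K`-rational point. -/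
def WeierstrassCurve.HasFullTorsionOver {F : Type*} [Field F] (E : WeierstrassCurve F) (n : ℕ)
    {L : Type*} [Field L] [IsAlgClosed L] [Algebra F L] (K : IntermediateField F L) : Prop :=
  ∀ P : (Affine.baseChange E L).Point, n • P = 0 →
    ∃ Q : (Affine.baseChange E K).Point, Affine.Point.map K.val Q = P

/-! Let `K` be the maximal abelian extension and `P` a `K`-point of order 4. If `2P` is not
rational, some conjugate of `P` has a different double; the two doubles generate the 2-torsion and
are halved over `K`, so the 4-torsion lies in `K` (`hasFullTorsionOver_four_of_two_nsmul_ne`), which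
is excluded. So `2P` is rational; moved to the origin, it gives the model with `b`, `d`. Halving the
origin puts `√(b + 2√d)` in `K`, and commutativity of the Galois group makes `d`, `b² - 4d` or `(b²
- 4d)d` a square (`isSquare_of_sq_eq_add_two_mul`). The middle case makes the 2-torsion rational;
halving then needs only square roots of rational numbers, so the 4-torsion is again in `K`
(`hasFullTorsionOver_four`). -/

/-! ### Square roots in abelian extensions -/

theorem mem_maximalAbelianExtension_of_sq_eq {F : Type*} [Field F] [CharZero F]
    {z : AlgebraicClosure F} {a : F} (h : z ^ 2 = algebraMap F _ a) :
    z ∈ maximalAbelianExtension F := by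
  have hint : IsIntegral F z := Algebra.IsIntegral.isIntegral z
  set N := IntermediateField.adjoin F {z}
  have hz : z ∈ N := IntermediateField.mem_adjoin_simple_self F z
  refine le_maximalAbelianExtension N ?_ hz
  have hfin : FiniteDimensional F N := IntermediateField.adjoin.finiteDimensional hint
  have hle : Module.finrank F N ≤ 2 := by
    rw [IntermediateField.adjoin.finrank hint]
    have := Polynomial.natDegree_le_of_dvd
      (minpoly.dvd F z (p := Polynomial.X ^ 2 - Polynomial.C a) (by simp [h]))
      (Polynomial.X_pow_sub_C_ne_zero two_pos a)
    rwa [Polynomial.natDegree_X_pow_sub_C] at this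
  have hpos : 0 < Module.finrank F N := Module.finrank_pos
  obtain h1 | h2 : Module.finrank F N = 1 ∨ Module.finrank F N = 2 := by omega
  · rw [IntermediateField.finrank_eq_one_iff] at h1
    rw [h1]
    infer_instance
  · have : Algebra.IsQuadraticExtension F N := { finrank_eq_two' := h2 }
    exact IsAbelianGalois.of_isCyclic F N

/-- If a quadratic extension of `F(√d)` generated by a square root of `b + 2√d` lies in an abelian
extension, then it is biquadratic or cyclic over `F`. -/
theorem isSquare_of_sq_eq_add_two_mul {F K : Type*} [Field F] [CharZero F] [Field K] [Algebra F K]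
    [IsAbelianGalois F K] {b d : F} {X w : K} (hX : X ^ 2 = algebraMap F K d)
    (hw : w ^ 2 = algebraMap F K b + 2 * X) (hdisc : b ^ 2 - 4 * d ≠ 0) :
    IsSquare d ∨ IsSquare (b ^ 2 - 4 * d) ∨ IsSquare ((b ^ 2 - 4 * d) * d) := by
  have : CharZero K := charZero_of_injective_algebraMap (algebraMap F K).injective
  have inj := (algebraMap F K).injective
  have mem_range (x : K) (h : ∀ τ : Gal(K/F), τ x = x) : ∃ r, algebraMap F K r = x :=
    (InfiniteGalois.mem_range_algebraMap_iff_fixed (k := F) (K := K) x).mpr h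
  by_cases h1 : IsSquare d
  · exact .inl h1
  by_cases h2 : IsSquare (b ^ 2 - 4 * d)
  · exact .inr (.inl h2)
  refine .inr (.inr ?_)
  have hXτ (τ : Gal(K/F)) : τ X = X ∨ τ X = -X := by
    apply sq_eq_sq_iff_eq_or_eq_neg.mp
    rw [← map_pow, hX, AlgEquiv.commutes]
  obtain ⟨σ, hσ⟩ : ∃ σ : Gal(K/F), σ X = -X := by
    by_contra! H
    obtain ⟨r, rfl⟩ := mem_range X fun τ => (hXτ τ).resolve_right (H τ)
    exact h1 ⟨r, inj (by rw [← hX, map_mul, sq])⟩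
  -- `v` is a square root of the conjugate `b - 2√d`, so `w * v` is a square root of `b² - 4d`.
  set v := σ w with hv
  have hv2 : v ^ 2 = algebraMap F K b - 2 * X := by
    rw [hv, ← map_pow, hw, map_add, AlgEquiv.commutes, map_mul, hσ, map_ofNat]
    ring
  have he : (w * v) ^ 2 = algebraMap F K (b ^ 2 - 4 * d) := by
    rw [mul_pow, hw, hv2, map_sub, map_pow, map_mul, ← hX, map_ofNat]
    ring
  have he0 : w * v ≠ 0 := by
    intro h
    rw [h] at he
    exact hdisc (inj (by rw [← he]; simp))
  have hv0 : v ≠ 0 := right_ne_zero_of_mul he0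
  have heτ (τ : Gal(K/F)) : τ (w * v) = w * v ∨ τ (w * v) = -(w * v) := by
    apply sq_eq_sq_iff_eq_or_eq_neg.mp
    rw [← map_pow, he, AlgEquiv.commutes]
  -- Since `τ` commutes with `σ`, it changes `w` and `v = σ w` by the same sign.
  have hfix (τ : Gal(K/F)) (hτ : τ X = X) : τ (w * v) = w * v := by
    have hτw : τ w = w ∨ τ w = -w := by
      apply sq_eq_sq_iff_eq_or_eq_neg.mp
      rw [← map_pow, hw, map_add, AlgEquiv.commutes, map_mul, hτ, map_ofNat]
    have hcomm : τ v = σ (τ w) := by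
      rw [hv, ← AlgEquiv.mul_apply, ← AlgEquiv.mul_apply, mul_comm' τ σ]
    rcases hτw with h | h
    · rw [map_mul, hcomm, h]
    · rw [map_mul, hcomm, h, map_neg, neg_mul_neg]
  obtain ⟨ρ, hρ⟩ : ∃ ρ : Gal(K/F), ρ (w * v) = -(w * v) := by
    by_contra! H
    obtain ⟨r, hr⟩ := mem_range (w * v) fun τ => (heτ τ).resolve_right (H τ)
    exact h2 ⟨r, inj (by rw [← he, map_mul, hr, sq])⟩
  have hne : -(w * v) ≠ w * v := fun h => he0 (by linear_combination (-1 / 2) * h)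
  have hρX : ρ X = -X := (hXτ ρ).resolve_left fun h => hne (by rw [← hρ, hfix ρ h])
  -- `w * v` and `X` change sign under the same automorphisms: if `τ` negates `X`, then `ρ * τ`
  -- fixes `X`, hence `w * v`. So their product is rational.
  obtain ⟨r, hr⟩ := mem_range (w * v * X) fun τ => by
    rcases hXτ τ with h | h
    · rw [map_mul, hfix τ h, h]
    · have h3 : (ρ * τ) (w * v) = w * v := hfix _ (by
        rw [AlgEquiv.mul_apply, h, map_neg, hρX, neg_neg])
      rcases heτ τ with h4 | h4
      · rw [AlgEquiv.mul_apply, h4, hρ] at h3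
        exact absurd h3 hne
      · rw [map_mul, h, h4, neg_mul_neg]
  exact ⟨r, inj (by rw [map_mul, ← he, ← hX, map_mul, hr]; ring)⟩

/-! ### Moving a point of order two to the origin -/

namespace WeierstrassCurve
/-- The coefficient `b` of the model `y² = x(x² + bx + d)` of a Weierstrass curve obtained by moving
a point of order two with abscissa `t` to the origin. -/
def twoTorsionB {F : Type*} [Field F] (W : WeierstrassCurve F) (t : F) : F := 3 * t + W.b₂ / 4

/-- The coefficient `d` of the model `y² = x(x² + bx + d)` of a Weierstrass curve obtained by moving
a point of order two with abscissa `t` to the origin. -/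
def twoTorsionD {F : Type*} [Field F] (W : WeierstrassCurve F) (t : F) : F :=
  3 * t ^ 2 + W.b₂ / 2 * t + W.b₄ / 2

theorem exists_variableChange_eq {F : Type*} [Field F] [CharZero F] (W : WeierstrassCurve F) {t : F}
    (ht : 4 * t ^ 3 + W.b₂ * t ^ 2 + 2 * W.b₄ * t + W.b₆ = 0) :
    ∃ C : VariableChange F, C • W = ⟨0, W.twoTorsionB t, 0, W.twoTorsionD t, 0⟩ := by
  -- Translate by `t` and complete the square in `y`.
  refine ⟨⟨1, t, -W.a₁ / 2, -(W.a₃ + t * W.a₁) / 2⟩, ?_⟩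
  simp only [b₂, b₄, b₆] at ht
  ext <;> simp only [variableChange_def, twoTorsionB, twoTorsionD, b₂, b₄, inv_one, Units.val_one]
  · ring
  · ring
  · ring
  · ring
  · linear_combination ht / 4

theorem twoTorsion_ne_zero {F : Type*} [Field F] [CharZero F] (W : WeierstrassCurve F)
    [W.IsElliptic] {t : F} (ht : 4 * t ^ 3 + W.b₂ * t ^ 2 + 2 * W.b₄ * t + W.b₆ = 0) :
    W.twoTorsionD t ≠ 0 ∧ W.twoTorsionB t ^ 2 - 4 * W.twoTorsionD t ≠ 0 := by
  obtain ⟨C, hC⟩ := W.exists_variableChange_eq ht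
  have h : (C • W).Δ ≠ 0 := (C • W).isUnit_Δ.ne_zero
  have h2 : (C • W).Δ =
      16 * W.twoTorsionD t ^ 2 * (W.twoTorsionB t ^ 2 - 4 * W.twoTorsionD t) := by
    rw [hC]
    simp only [Δ, b₂, b₄, b₆, b₈]
    ring
  rw [h2] at h
  constructor <;> rintro h0 <;> simp [h0] at h

/-! ### Halving and the two-torsion -/

namespace Affine

variable {F : Type*} [Field F] {W : Affine F}

theorem twoTorsion_equation [CharZero F] {x y : F} (h : W.Equation x y) (hy : y = W.negY x y) :
    4 * x ^ 3 + W.b₂ * x ^ 2 + 2 * W.b₄ * x + W.b₆ = 0 := by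
  rw [equation_iff] at h
  rw [negY] at hy
  simp only [b₂, b₄, b₆]
  linear_combination -4 * h + (2 * y + W.a₁ * x + W.a₃) * hy

theorem eq_of_eq_negY [CharZero F] {x y : F} (hy : y = W.negY x y) :
    y = -(W.a₁ * x + W.a₃) / 2 := by
  rw [negY] at hy
  linear_combination hy / 2

variable [DecidableEq F]

theorem Point.two_nsmul_some_eq_zero_iff {x y : F} (h : W.Nonsingular x y) :
    2 • Point.some x y h = 0 ↔ y = W.negY x y := by
  rw [two_nsmul]
  refine ⟨fun h0 => ?_, fun hy => Point.add_self_of_Y_eq hy⟩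
  by_contra hy
  rw [Point.add_self_of_Y_ne hy] at h0
  exact Point.some_ne_zero _ h0

/-- With the doubled point at the origin, the duplication formula makes its abscissa `(X² - d)² /
(4Y²)`, where `X = x - t` and `Y` completes the square. It vanishes, so `X² = d`, and the curve
equation becomes `Y² = X²(b + 2X)`. -/
theorem halving_equations [CharZero F] {x y t s : F} {h : W.Nonsingular x y}
    {h' : W.Nonsingular t s} (h2 : 2 • Point.some x y h = Point.some t s h')
    (hs : s = W.negY t s) :
    (x - t) ^ 2 = W.twoTorsionD t ∧
      (y + (W.a₁ * x + W.a₃) / 2) ^ 2 = (x - t) ^ 2 * (W.twoTorsionB t + 2 * (x - t)) := by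
  have hy : y ≠ W.negY x y := fun hy => by
    rw [(Point.two_nsmul_some_eq_zero_iff h).mpr hy] at h2
    exact Point.some_ne_zero _ h2.symm
  rw [two_nsmul, Point.add_self_of_Y_ne hy] at h2
  have hx := (Point.some.inj h2).1
  have hy' : y - W.negY x y ≠ 0 := sub_ne_zero.mpr hy
  have ht := twoTorsion_equation h'.1 hs
  have he := h.1
  rw [equation_iff] at he
  set m := W.slope x x y y with hm
  have hm' : m * (2 * y + W.a₁ * x + W.a₃) = 3 * x ^ 2 + 2 * W.a₂ * x + W.a₄ - W.a₁ * y := by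
    have : y - W.negY x y = 2 * y + W.a₁ * x + W.a₃ := by rw [negY]; ring
    rw [hm, slope_of_Y_ne rfl hy, ← this, div_mul_cancel₀ _ hy']
  rw [addX] at hx
  simp only [b₂, b₄, b₆] at ht
  set b := W.twoTorsionB t with hb
  set d := W.twoTorsionD t with hd
  have hYY : (y + (W.a₁ * x + W.a₃) / 2) ^ 2 = (x - t) * ((x - t) ^ 2 + b * (x - t) + d) := by
    simp only [hb, hd, twoTorsionB, twoTorsionD, b₂, b₄]
    linear_combination he + ht / 4
  have hmY : (m + W.a₁ / 2) * (2 * (y + (W.a₁ * x + W.a₃) / 2)) =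
      3 * (x - t) ^ 2 + 2 * b * (x - t) + d := by
    simp only [hb, hd, twoTorsionB, twoTorsionD, b₂, b₄]
    linear_combination hm'
  have hmm : (m + W.a₁ / 2) ^ 2 = b + 2 * (x - t) := by
    simp only [hb, twoTorsionB, b₂]
    linear_combination hx
  have h1 : (x - t) ^ 2 = d := by
    have : ((x - t) ^ 2 - d) ^ 2 = 0 := by
      linear_combination (-(3 * (x - t) ^ 2 + 2 * b * (x - t) + d) -
        (m + W.a₁ / 2) * (2 * (y + (W.a₁ * x + W.a₃) / 2))) * hmY +
        4 * (y + (W.a₁ * x + W.a₃) / 2) ^ 2 * hmm + 4 * (b + 2 * (x - t)) * hYY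
    exact sub_eq_zero.mp (pow_eq_zero_iff two_ne_zero |>.mp this)
  refine ⟨h1, ?_⟩
  rw [hYY]
  linear_combination (-(x - t)) * h1

/-- Two distinct points of order two generate the two-torsion. -/
theorem Point.eq_of_two_nsmul_eq_zero [CharZero F] {T T' U : W.Point} (hT : 2 • T = 0)
    (hT' : 2 • T' = 0) (hU : 2 • U = 0) (hT0 : T ≠ 0) (hT'0 : T' ≠ 0) (hne : T ≠ T') :
    U = 0 ∨ U = T ∨ U = T' ∨ U = T + T' := by
  by_contra! H
  obtain ⟨h0, h1, h2, h3⟩ := H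
  -- Otherwise `T`, `T'`, `U`, `T + T'` would have four distinct abscissas, all roots of one cubic.
  obtain ⟨V, hV⟩ : ∃ V, V = T + T' := ⟨_, rfl⟩
  have hV2 : 2 • V = 0 := by rw [hV, nsmul_add, hT, hT', add_zero]
  have hV0 : V ≠ 0 := fun h => hne <| by
    have e : T = -T' := eq_neg_of_add_eq_zero_left (hV ▸ h)
    have e' : T' = -T' := eq_neg_of_add_eq_zero_left (by rw [← two_nsmul, hT'])
    rw [e, ← e']
  have hVT : V ≠ T := fun h => hT'0 (by simpa [h] using hV)
  have hVT' : V ≠ T' := fun h => hT0 (by simpa [h] using hV)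
  rw [← hV] at h3
  clear hV
  rcases T with _ | ⟨x₁, y₁, n₁⟩
  · exact hT0 rfl
  rcases T' with _ | ⟨x₂, y₂, n₂⟩
  · exact hT'0 rfl
  rcases U with _ | ⟨x₃, y₃, n₃⟩
  · exact h0 rfl
  rcases V with _ | ⟨x₄, y₄, n₄⟩
  · exact hV0 rfl
  rw [two_nsmul_some_eq_zero_iff] at hT hT' hU hV2
  have hx {x y x' y' : F} {n : W.Nonsingular x y} {n' : W.Nonsingular x' y'}
      (hy : y = W.negY x y) (hy' : y' = W.negY x' y')
      (h : Point.some x y n ≠ Point.some x' y' n') : x - x' ≠ 0 := by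
    intro e
    obtain rfl := sub_eq_zero.mp e
    refine h ?_
    have : y = y' := by rw [eq_of_eq_negY hy, eq_of_eq_negY hy']
    subst this
    rfl
  have e₁ := twoTorsion_equation n₁.1 hT
  have e₂ := twoTorsion_equation n₂.1 hT'
  have e₃ := twoTorsion_equation n₃.1 hU
  have e₄ := twoTorsion_equation n₄.1 hV2
  have d₁₂ := hx hT hT' hne
  have d₃₁ := hx hU hT h1
  have d₃₂ := hx hU hT' h2
  have d₃₄ := hx hU hV2 h3
  have d₄₁ := hx hV2 hT hVT
  have d₄₂ := hx hV2 hT' hVT'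
  -- Divided differences of the cubic, first of order one, then of order two.
  have f₂ : 4 * (x₁ ^ 2 + x₁ * x₂ + x₂ ^ 2) + W.b₂ * (x₁ + x₂) + 2 * W.b₄ = 0 :=
    mul_left_cancel₀ d₁₂ (by linear_combination e₁ - e₂)
  have f₃ : 4 * (x₁ ^ 2 + x₁ * x₃ + x₃ ^ 2) + W.b₂ * (x₁ + x₃) + 2 * W.b₄ = 0 :=
    mul_left_cancel₀ d₃₁ (by linear_combination e₃ - e₁)
  have f₄ : 4 * (x₁ ^ 2 + x₁ * x₄ + x₄ ^ 2) + W.b₂ * (x₁ + x₄) + 2 * W.b₄ = 0 :=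
    mul_left_cancel₀ d₄₁ (by linear_combination e₄ - e₁)
  have g₃ : 4 * (x₁ + x₂ + x₃) + W.b₂ = 0 :=
    mul_left_cancel₀ d₃₂ (by linear_combination f₃ - f₂)
  have g₄ : 4 * (x₁ + x₂ + x₄) + W.b₂ = 0 :=
    mul_left_cancel₀ d₄₂ (by linear_combination f₄ - f₂)
  exact d₃₄ (by linear_combination (g₃ - g₄) / 4)

end Affine

/-! ### Criteria for full four-torsion -/

open scoped Classical in
theorem Affine.Point.exists_map_val_eq_some {F L : Type*} [Field F] [Field L] [Algebra F L]
    {E : WeierstrassCurve F} {K : IntermediateField F L} {x y : L}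
    (h : (Affine.baseChange E L).Nonsingular x y) (hx : x ∈ K) (hy : y ∈ K) :
    ∃ Q : (Affine.baseChange E K).Point, Affine.Point.map K.val Q = .some x y h :=
  ⟨.some ⟨x, hx⟩ ⟨y, hy⟩ ((Affine.baseChange_nonsingular E K.val.injective ..).mp h), rfl⟩

/-- The coordinate `y` lies in `K` as soon as `x` and `y + (a₁x + a₃) / 2` do. -/
theorem mem_of_completed_square_mem {F L : Type*} [Field F] [CharZero F] [Field L] [Algebra F L]
    (E : WeierstrassCurve F) (K : IntermediateField F L) {x y : L} (hx : x ∈ K)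
    (h : y + ((Affine.baseChange E L).a₁ * x + (Affine.baseChange E L).a₃) / 2 ∈ K) : y ∈ K := by
  have h1 : ((Affine.baseChange E L).a₁ * x + (Affine.baseChange E L).a₃) / 2 ∈ K :=
    K.div_mem (K.add_mem (K.mul_mem (K.algebraMap_mem E.a₁) hx) (K.algebraMap_mem E.a₃))
      (ofNat_mem K 2)
  simpa using K.sub_mem h h1

open scoped Classical in
/-- Halves of a rational point of order two are defined over the maximal abelian extension when
the other two points of order two are rational too. -/
theorem mem_maximalAbelianExtension_of_halving {F : Type*} [Field F] [CharZero F]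
    {E : WeierstrassCurve F} {r₁ r₂ r₃ : F} (h₂ : E.b₂ = -4 * (r₁ + r₂ + r₃))
    (h₄ : E.b₄ = 2 * (r₁ * r₂ + r₁ * r₃ + r₂ * r₃)) {x y s : AlgebraicClosure F}
    {h : (Affine.baseChange E (AlgebraicClosure F)).Nonsingular x y}
    {h' : (Affine.baseChange E (AlgebraicClosure F)).Nonsingular (algebraMap F _ r₁) s}
    (hP : 2 • Affine.Point.some x y h = Affine.Point.some _ s h')
    (hs : s = (Affine.baseChange E (AlgebraicClosure F)).negY (algebraMap F _ r₁) s) :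
    x ∈ maximalAbelianExtension F ∧ y ∈ maximalAbelianExtension F := by
  set φ := algebraMap F (AlgebraicClosure F)
  set K := maximalAbelianExtension F
  obtain ⟨hX, hY⟩ := Affine.halving_equations hP hs
  have hB : (Affine.baseChange E (AlgebraicClosure F)).twoTorsionB (φ r₁) =
      φ (2 * r₁ - r₂ - r₃) := by
    have : (Affine.baseChange E (AlgebraicClosure F)).b₂ = φ E.b₂ := E.map_b₂ φ
    rw [twoTorsionB, this, h₂]
    simp only [map_mul, map_add, map_sub, map_neg, map_ofNat]
    ring
  have hD : (Affine.baseChange E (AlgebraicClosure F)).twoTorsionD (φ r₁) =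
      φ ((r₁ - r₂) * (r₁ - r₃)) := by
    have e₂ : (Affine.baseChange E (AlgebraicClosure F)).b₂ = φ E.b₂ := E.map_b₂ φ
    have e₄ : (Affine.baseChange E (AlgebraicClosure F)).b₄ = φ E.b₄ := E.map_b₄ φ
    rw [twoTorsionD, e₂, e₄, h₂, h₄]
    simp only [map_mul, map_add, map_sub, map_neg, map_ofNat]
    ring
  rw [hD] at hX
  rw [hB] at hY
  set X := x - φ r₁ with hXdef
  set Y := y + ((Affine.baseChange E (AlgebraicClosure F)).a₁ * x +
    (Affine.baseChange E (AlgebraicClosure F)).a₃) / 2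
  have hXK : X ∈ K := mem_maximalAbelianExtension_of_sq_eq hX
  have hxK : x ∈ K := by
    have := K.add_mem hXK (K.algebraMap_mem r₁)
    rwa [hXdef, sub_add_cancel] at this
  refine ⟨hxK, mem_of_completed_square_mem E K hxK ?_⟩
  -- With `p² = r₁ - r₂`, `q² = r₁ - r₃` and `pq = X`, the factor `b + 2X` is `(p + q)²`.
  obtain ⟨p, hp⟩ := IsAlgClosed.exists_pow_nat_eq (φ (r₁ - r₂)) two_pos
  obtain ⟨q, hq, hpq⟩ : ∃ q, q ^ 2 = φ (r₁ - r₃) ∧ X = p * q := by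
    obtain ⟨q, hq⟩ := IsAlgClosed.exists_pow_nat_eq (φ (r₁ - r₃)) two_pos
    have : X ^ 2 = (p * q) ^ 2 := by rw [mul_pow, hp, hq, hX, map_mul]
    rcases sq_eq_sq_iff_eq_or_eq_neg.mp this with h | h
    · exact ⟨q, hq, h⟩
    · exact ⟨-q, by rw [neg_sq, hq], by rw [h, mul_neg]⟩
  have hpK : p ∈ K := mem_maximalAbelianExtension_of_sq_eq hp
  have hqK : q ∈ K := mem_maximalAbelianExtension_of_sq_eq hq
  have : Y ^ 2 = (X * (p + q)) ^ 2 := by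
    rw [hY, mul_pow]
    congr 1
    rw [add_sq, hp, hq, mul_assoc, ← hpq]
    simp only [map_mul, map_sub, map_ofNat]
    ring
  have hm : X * (p + q) ∈ K := K.mul_mem hXK (K.add_mem hpK hqK)
  have hYK : Y ∈ K := by
    rcases sq_eq_sq_iff_eq_or_eq_neg.mp this with h | h <;> rw [h]
    exacts [hm, K.neg_mem hm]
  exact hYK

/-- Full rational two-torsion forces full four-torsion over the maximal abelian extension. -/
theorem hasFullTorsionOver_four {F : Type*} [Field F] [CharZero F] {E : WeierstrassCurve F}
    {r₁ r₂ r₃ : F} (h₂ : E.b₂ = -4 * (r₁ + r₂ + r₃))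
    (h₄ : E.b₄ = 2 * (r₁ * r₂ + r₁ * r₃ + r₂ * r₃)) (h₆ : E.b₆ = -4 * (r₁ * r₂ * r₃)) :
    E.HasFullTorsionOver 4 (maximalAbelianExtension F) := by
  classical
  set φ := algebraMap F (AlgebraicClosure F)
  have roots {t s : AlgebraicClosure F}
      (h : (Affine.baseChange E (AlgebraicClosure F)).Equation t s)
      (hs : s = (Affine.baseChange E (AlgebraicClosure F)).negY t s) :
      t = φ r₁ ∨ t = φ r₂ ∨ t = φ r₃ := by
    have e := Affine.twoTorsion_equation h hs
    have e₂ : (Affine.baseChange E (AlgebraicClosure F)).b₂ = φ E.b₂ := E.map_b₂ φ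
    have e₄ : (Affine.baseChange E (AlgebraicClosure F)).b₄ = φ E.b₄ := E.map_b₄ φ
    have e₆ : (Affine.baseChange E (AlgebraicClosure F)).b₆ = φ E.b₆ := E.map_b₆ φ
    rw [e₂, e₄, e₆, h₂, h₄, h₆] at e
    simp only [map_mul, map_add, map_neg, map_ofNat] at e
    have : (t - φ r₁) * ((t - φ r₂) * (t - φ r₃)) = 0 := by linear_combination e / 4
    simpa only [mul_eq_zero, sub_eq_zero] using this
  intro R hR
  rcases R with _ | ⟨x, y, n⟩
  · exact ⟨0, rfl⟩
  suffices x ∈ maximalAbelianExtension F ∧ y ∈ maximalAbelianExtension F from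
    Affine.Point.exists_map_val_eq_some n this.1 this.2
  rw [show 4 = 2 * 2 from rfl, mul_nsmul] at hR
  rcases hU : 2 • Affine.Point.some x y n with _ | ⟨t, s, n'⟩
  · have hy := (Affine.Point.two_nsmul_some_eq_zero_iff n).mp hU
    have hx : x ∈ maximalAbelianExtension F := by
      rcases roots n.1 hy with rfl | rfl | rfl <;> exact algebraMap_mem _ _
    refine ⟨hx, mem_of_completed_square_mem E _ hx ?_⟩
    rw [Affine.eq_of_eq_negY hy, neg_div, neg_add_cancel]
    exact zero_mem _
  · rw [hU] at hR
    have hs := (Affine.Point.two_nsmul_some_eq_zero_iff n').mp hR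
    rcases roots n'.1 hs with rfl | rfl | rfl
    · exact mem_maximalAbelianExtension_of_halving h₂ h₄ hU hs
    · exact mem_maximalAbelianExtension_of_halving (r₂ := r₁) (r₃ := r₃) (by rw [h₂]; ring)
        (by rw [h₄]; ring) hU hs
    · exact mem_maximalAbelianExtension_of_halving (r₂ := r₁) (r₃ := r₂) (by rw [h₂]; ring)
        (by rw [h₄]; ring) hU hs

open scoped Classical in
/-- Two points of order four whose doubles differ generate the four-torsion. -/
theorem hasFullTorsionOver_four_of_two_nsmul_ne {F L : Type*} [Field F] [CharZero F] [Field L]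
    [IsAlgClosed L] [Algebra F L] {E : WeierstrassCurve F} {K : IntermediateField F L}
    {P P' : (Affine.baseChange E K).Point} (hP : addOrderOf P = 4) (hP' : addOrderOf P' = 4)
    (hne : 2 • P ≠ 2 • P') : E.HasFullTorsionOver 4 K := by
  have : CharZero L := charZero_of_injective_algebraMap (algebraMap F L).injective
  set f := Affine.Point.map (W' := E) K.val with hf
  have finj : Function.Injective f := Affine.Point.map_injective _
  have h4 {Q : (Affine.baseChange E K).Point} (h : addOrderOf Q = 4) : 2 • (2 • Q) = 0 := by
    rw [← mul_nsmul, show 2 * 2 = 4 from rfl, ← h, addOrderOf_nsmul_eq_zero]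
  have h2 {Q : (Affine.baseChange E K).Point} (h : addOrderOf Q = 4) : f (2 • Q) ≠ 0 := by
    intro h0
    have := Nat.le_of_dvd two_pos (addOrderOf_dvd_of_nsmul_eq_zero
      (finj (h0.trans (_root_.map_zero f).symm)))
    omega
  have key {U : (Affine.baseChange E L).Point} (hU : 2 • U = 0) :
      U = 0 ∨ U = f (2 • P) ∨ U = f (2 • P') ∨ U = f (2 • P) + f (2 • P') :=
    Affine.Point.eq_of_two_nsmul_eq_zero (by rw [← map_nsmul, h4 hP, _root_.map_zero])
      (by rw [← map_nsmul, h4 hP', _root_.map_zero]) hU (h2 hP) (h2 hP') (finj.ne hne)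
  intro R hR
  rw [show 4 = 2 * 2 from rfl, mul_nsmul] at hR
  -- Every 2-torsion point is the double of a `K`-point, so `R` differs from a `K`-point by
  -- 2-torsion, itself defined over `K`.
  obtain ⟨Q, hQ⟩ : ∃ Q, 2 • R = f (2 • Q) := by
    rcases key hR with h | h | h | h
    exacts [⟨0, by simp [h]⟩, ⟨P, h⟩, ⟨P', h⟩, ⟨P + P', by rw [h, nsmul_add, map_add]⟩]
  have hV : 2 • (R - f Q) = 0 := by rw [nsmul_sub, hQ, map_nsmul, sub_self]
  obtain ⟨Q', hQ'⟩ : ∃ Q', f Q' = R - f Q := by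
    rcases key hV with h | h | h | h
    exacts [⟨0, by rw [h, _root_.map_zero]⟩, ⟨_, h.symm⟩, ⟨_, h.symm⟩, ⟨_, by rw [h, map_add]⟩]
  exact ⟨Q' + Q, by rw [← hf, map_add, hQ', sub_add_cancel]⟩

/-! ### Galois descent and conclusion -/

/-- For a point `P` of order four over a Galois extension, either a conjugate of `P` has a different
double, or the double of `P` is rational, in which case `P` is given by explicit radicals. -/
theorem exists_two_nsmul_ne_or_exists_halving {F K : Type*} [Field F] [CharZero F] [Field K]
    [Algebra F K] [IsGalois F K] [DecidableEq K] {E : WeierstrassCurve F} [E.IsElliptic]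
    {P : (Affine.baseChange E K).Point} (hP : addOrderOf P = 4) :
    (∃ P' : (Affine.baseChange E K).Point, addOrderOf P' = 4 ∧ 2 • P' ≠ 2 • P) ∨
    ∃ r : F, 4 * r ^ 3 + E.b₂ * r ^ 2 + 2 * E.b₄ * r + E.b₆ = 0 ∧
      ∃ X w : K, X ^ 2 = algebraMap F K (E.twoTorsionD r) ∧
        w ^ 2 = algebraMap F K (E.twoTorsionB r) + 2 * X := by
  have : CharZero K := charZero_of_injective_algebraMap (algebraMap F K).injective
  set φ := algebraMap F K
  have hT2 : 2 • (2 • P) = 0 := by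
    rw [← mul_nsmul, show 2 * 2 = 4 from rfl, ← hP, addOrderOf_nsmul_eq_zero]
  rcases hT : 2 • P with _ | ⟨t, s, n'⟩
  · have := Nat.le_of_dvd two_pos (addOrderOf_dvd_of_nsmul_eq_zero hT)
    omega
  rw [hT] at hT2
  have hs := (Affine.Point.two_nsmul_some_eq_zero_iff n').mp hT2
  by_cases hr : ∃ r, φ r = t
  swap
  -- If all conjugates of `P` had the same double, its abscissa `t` would be Galois-fixed.
  · left
    by_contra! H
    refine hr ((InfiniteGalois.mem_range_algebraMap_iff_fixed (k := F) t).mpr fun σ => ?_)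
    have h := H (Affine.Point.map (W' := E) (σ : K →ₐ[F] K) P)
      ((addOrderOf_injective _ (Affine.Point.map_injective _) P).trans hP)
    rw [← map_nsmul, hT, Affine.Point.map_some] at h
    exact (Affine.Point.some.inj h).1
  obtain ⟨r, rfl⟩ := hr
  right
  rcases P with _ | ⟨x, y, n⟩
  · exact absurd (hT.symm.trans (nsmul_zero 2)) (Affine.Point.some_ne_zero _)
  have e₂ : (Affine.baseChange E K).b₂ = φ E.b₂ := E.map_b₂ φ
  have e₄ : (Affine.baseChange E K).b₄ = φ E.b₄ := E.map_b₄ φ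
  have e₆ : (Affine.baseChange E K).b₆ = φ E.b₆ := E.map_b₆ φ
  have hr : 4 * r ^ 3 + E.b₂ * r ^ 2 + 2 * E.b₄ * r + E.b₆ = 0 := by
    have := Affine.twoTorsion_equation n'.1 hs
    rw [e₂, e₄, e₆] at this
    exact φ.injective (by simpa only [map_add, map_mul, map_pow, map_ofNat, map_zero] using this)
  have hB : (Affine.baseChange E K).twoTorsionB (φ r) = φ (E.twoTorsionB r) := by
    simp only [twoTorsionB, e₂, map_add, map_mul, map_div₀, map_ofNat]
  have hD : (Affine.baseChange E K).twoTorsionD (φ r) = φ (E.twoTorsionD r) := by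
    simp only [twoTorsionD, e₂, e₄, map_add, map_mul, map_pow, map_div₀, map_ofNat]
  obtain ⟨hX, hY⟩ := Affine.halving_equations hT hs
  rw [hD] at hX
  rw [hB] at hY
  obtain ⟨hd, -⟩ := E.twoTorsion_ne_zero hr
  have hX0 : x - φ r ≠ 0 := fun h => hd (φ.injective (by rw [← hX, h]; simp))
  refine ⟨r, hr, x - φ r, (y + ((Affine.baseChange E K).a₁ * x +
    (Affine.baseChange E K).a₃) / 2) / (x - φ r), hX, ?_⟩
  rw [div_pow, hY, mul_div_cancel_left₀ _ (pow_ne_zero 2 hX0)]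

/-- A point of order four over the maximal abelian extension of `F`, without full four-torsion there,
forces a model `y² = x(x² + bx + d)` with `d` or `(b² - 4d)d` a nonzero square. -/
theorem exists_variableChange_of_hasPointOfOrderOver_four {F : Type*} [Field F] [CharZero F]
    (E : WeierstrassCurve F) [E.IsElliptic]
    (h4 : E.HasPointOfOrderOver 4 (maximalAbelianExtension F))
    (hfull : ¬ E.HasFullTorsionOver 4 (maximalAbelianExtension F)) :
    ∃ (b d : F) (C : VariableChange F),
      C • E = { a₁ := 0, a₂ := b, a₃ := 0, a₄ := d, a₆ := 0 } ∧
      ((d ≠ 0 ∧ IsSquare d) ∨ ((b ^ 2 - 4 * d) * d ≠ 0 ∧ IsSquare ((b ^ 2 - 4 * d) * d))) := by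
  classical
  have := isAbelianGalois_maximalAbelianExtension F
  obtain ⟨P, hP⟩ : ∃ P : (Affine.baseChange E (maximalAbelianExtension F)).Point,
      addOrderOf P = 4 := by
    unfold HasPointOfOrderOver at h4
    convert h4
  obtain ⟨P', hP', hne⟩ | ⟨r, hr, X, w, hX, hw⟩ := exists_two_nsmul_ne_or_exists_halving hP
  · exact absurd (hasFullTorsionOver_four_of_two_nsmul_ne hP' hP hne) hfull
  obtain ⟨hd, hdisc⟩ := E.twoTorsion_ne_zero hr
  obtain ⟨C, hC⟩ := E.exists_variableChange_eq hr
  refine ⟨E.twoTorsionB r, E.twoTorsionD r, C, hC, ?_⟩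
  rcases isSquare_of_sq_eq_add_two_mul hX hw hdisc with h | ⟨e, he⟩ | h
  · exact .inl ⟨hd, h⟩
  -- The roots of `x² + bx + d`, shifted back by `r`, are the other two abscissas.
  · refine absurd (hasFullTorsionOver_four (r₁ := r) (r₂ := r + (-E.twoTorsionB r + e) / 2)
      (r₃ := r + (-E.twoTorsionB r - e) / 2) ?_ ?_ ?_) hfull <;>
    simp only [twoTorsionB, twoTorsionD] at he ⊢
    · ring
    · linear_combination -he / 2
    · linear_combination hr + r * he
  · exact .inr ⟨mul_ne_zero hdisc hd, h⟩

end WeierstrassCurve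

theorem mainTheorem12 (E : WeierstrassCurve ℚ) [E.IsElliptic]
    (h4 : E.HasPointOfOrderOver 4 (maximalAbelianExtension ℚ))
    (hfull : ¬ E.HasFullTorsionOver 4 (maximalAbelianExtension ℚ)) :
    ∃ (b d : ℚ) (C : VariableChange ℚ),
      C • E = { a₁ := 0, a₂ := b, a₃ := 0, a₄ := d, a₆ := 0 } ∧
      ((d ≠ 0 ∧ IsSquare d) ∨ ((b ^ 2 - 4 * d) * d ≠ 0 ∧ IsSquare ((b ^ 2 - 4 * d) * d))) :=
  E.exists_variableChange_of_hasPointOfOrderOver_four h4 hfull
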